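/- Let $n\in\mathbb N$ and let $\nu$ be a measure on $\mathbb R^n$ concentrated on $\mathbb Z^n\setminus\{\mathbf 0\}$ with $\int_{\mathbb R^n}\min(1,\|\mathbf y\|)\,\nu(d\mathbf y)<\infty$. Let $N$ be a Poisson random measure on $\mathbb R^n\times[0,1]\times\mathbb R$, defined on a probability space $(\Omega,\mathcal F,P)$, with intensity measure $\nu(d\mathbf y)\,dx\,ds$. For Borel sets $B\subset[0,1]\times\mathbb R$ of finite Lebesgue measure put $$\mathbf L(B)=(L^{(1)}(B),\dots,L^{(n)}(B))^\top=\int \mathbf y\,\mathbf 1_B(x,s)\,N(d\mathbf y,dx,ds)$$ (the integer-valued Lévy basis). Let $\mathbf L'=(L'^{(1)},\dots,L'^{(n)})^\top$ be the corresponding Lévy seed, that is, a random vector with $$\mathbb E\,e^{i\boldsymbol\theta^\top\mathbf L'}=\exp\Big(\int_{\mathbb R^n}(e^{i\boldsymbol\theta^\top\mathbf y}-1)\,\nu(d\mathbf y)\Big),\qquad \boldsymbol\theta\in\mathbb R^n.$$ For a random vector $\mathbf X$, let $C_{\mathbf X}$ denote its cumulant function, i.e. the distinguished logarithm of its characteristic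 function: the unique continuous function with $C_{\mathbf X}(\mathbf 0)=0$ and $\mathbb E\,e^{i\boldsymbol\theta^\top\mathbf X}=e^{C_{\mathbf X}(\boldsymbol\theta)}$ for all $\boldsymbol\theta$. Let $A^{(1)},\dots,A^{(n)}$ be trawls, i.e. Borel subsets of $[0,1]\times(-\infty,0]$ of finite Lebesgue measure, let $A^{(i)}_t=A^{(i)}+(0,t)$, and let $$\mathbf Y_t=\big(L^{(1)}(A^{(1)}_t),\dots,L^{(n)}(A^{(n)}_t)\big)^\top,\qquad t\in\mathbb R,$$ be the multivariate integer-valued trawl process. Then, for every $t\in\mathbb R$, the integrals defining $\mathbf Y_t$ exist almost surely, $\mathbf Y_t$ is a random vector (measurable up to modification on a null set), the cumulant functions of $\mathbf Y_t$ and of all sub-vectors of $\mathbf L'$ exist, and for every $\boldsymbol\theta\in\mathbb R^n$ one has $\mathbb E\,e^{i\boldsymbol\theta^\top\mathbf Y_t}=\exp(C_{\mathbf Y_t}(\boldsymbol\theta))$ with $$C_{\mathbf Y_t}(\boldsymbol\theta)=\sum_{k=1}^n\ \sum_{\substack{S\subset\{1,\dots,n\}\\ |S|=k}}\mathrm{Leb}\Big(\bigcap_{i\in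 S}A^{(i)}\setminus\bigcup_{j\notin S}A^{(j)}\Big)\,C_{(L'^{(i)})_{i\in S}}\big((\theta_i)_{i\in S}\big).$$ -/

import Mathlib

open MeasureTheory ProbabilityTheory
open scoped ENNReal unitInterval

noncomputable section

namespace Trawl

/-! ### Cumulant functions (distinguished logarithms of characteristic functions) -/

/-- `C` is a distinguished logarithm of the characteristic function of the measure `m` on `ℝ^ι`:
it is continuous, vanishes at the origin, and `exp (C θ)` is the characteristic function. -/
structure IsCumulantFunction {ι : Type*} [Fintype ι] (m : Measure (EuclideanSpace ℝ ι))
    (C : EuclideanSpace ℝ ι → ℂ) : Prop where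
  continuous : Continuous C
  map_zero : C 0 = 0
  exp_eq : ∀ θ, charFun m θ = Complex.exp (C θ)

/-- The distinguished logarithm is unique. -/
theorem IsCumulantFunction.unique {ι : Type*} [Fintype ι] {m : Measure (EuclideanSpace ℝ ι)}
    {C D : EuclideanSpace ℝ ι → ℂ} (hC : IsCumulantFunction m C) (hD : IsCumulantFunction m D) :
    C = D := by
  have key : ∀ θ, ∃ k : ℤ, C θ = D θ + k * (2 * Real.pi * Complex.I) := fun θ =>
    Complex.exp_eq_exp_iff_exists_int.1 ((hC.exp_eq θ).symm.trans (hD.exp_eq θ))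
  choose k hk using key
  have h2 : (2 * Real.pi * Complex.I : ℂ) ≠ 0 := Complex.two_pi_I_ne_zero
  have hkC : ∀ θ, ((k θ : ℝ) : ℂ) = (C θ - D θ) / (2 * Real.pi * Complex.I) := fun θ => by
    rw [hk θ]; field_simp; push_cast; ring
  have hcont : Continuous fun θ => ((k θ : ℤ) : ℝ) := by
    have h : Continuous fun θ => (((k θ : ℝ) : ℂ)).re := by
      simp only [hkC]
      exact Complex.continuous_re.comp ((hC.continuous.sub hD.continuous).div_const _)
    simpa using h
  have hk' : Continuous k := Int.isClosedEmbedding_coe_real.isInducing.continuous_iff.2 hcont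
  have h0 : k 0 = 0 := by
    have h := hkC 0
    rw [hC.map_zero, hD.map_zero] at h
    simpa using h
  funext θ
  have h : k θ = 0 := (PreconnectedSpace.constant inferInstance hk').trans h0
  rw [hk θ, h]; simp

open Classical in
/-- The cumulant function of `m`: the distinguished logarithm of its characteristic function
(with the value `0` if there is none). -/
def cumulantFunction {ι : Type*} [Fintype ι] (m : Measure (EuclideanSpace ℝ ι)) :
    EuclideanSpace ℝ ι → ℂ :=
  if h : ∃ C, IsCumulantFunction m C then h.choose else 0

theorem IsCumulantFunction.cumulantFunction_eq {ι : Type*} [Fintype ι]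
    {m : Measure (EuclideanSpace ℝ ι)} {C : EuclideanSpace ℝ ι → ℂ}
    (hC : IsCumulantFunction m C) : cumulantFunction m = C := by
  have h : ∃ C, IsCumulantFunction m C := ⟨C, hC⟩
  rw [cumulantFunction, dif_pos h]
  exact h.choose_spec.unique hC

/-! ### Poisson random measures -/

/-- `N` is a Poisson random measure on `E` with intensity measure `μ`: a random measure whose value
on a measurable set `B` is Poisson distributed with mean `μ B` (almost surely infinite if
`μ B = ∞`) and whose values on finitely many pairwise disjoint measurable sets are independent. -/
structure IsPoissonRandomMeasure {E Ω : Type*} [MeasurableSpace E] [MeasurableSpace Ω]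
    (N : Ω → Measure E) (μ : Measure E) (P : Measure Ω) : Prop where
  measurable_eval : ∀ B, MeasurableSet B → Measurable fun ω => N ω B
  law_of_lt_top : ∀ B, MeasurableSet B → μ B < ∞ →
    P.map (fun ω => N ω B) =
      (poissonMeasure (μ B).toNNReal).map (fun k : ℕ => (k : ℝ≥0∞))
  ae_eq_top : ∀ B, MeasurableSet B → μ B = ∞ → ∀ᵐ ω ∂P, N ω B = ∞
  indep : ∀ (m : ℕ) (B : Fin m → Set E), (∀ i, MeasurableSet (B i)) →
    (Pairwise fun i j => Disjoint (B i) (B j)) → iIndepFun (fun i ω => N ω (B i)) P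

/-! ### The Lévy measure, the Lévy basis and the Lévy seed -/

/-- `ν` is a measure on `ℝⁿ` concentrated on `ℤⁿ \ {0}` with `∫ min(1, ‖y‖) ν(dy) < ∞`
(which makes it a Lévy measure). -/
structure IsIntegerLevyMeasure {n : ℕ} (ν : Measure (EuclideanSpace ℝ (Fin n))) : Prop where
  concentrated : ν {y | y ≠ 0 ∧ ∀ i, ∃ k : ℤ, y i = k}ᶜ = 0
  lintegral_lt_top : ∫⁻ y, ENNReal.ofReal (min 1 ‖y‖) ∂ν < ∞

/-- The state space `ℝⁿ × [0,1] × ℝ`, with points `(y, x, s)`. -/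
abbrev StateSpace (n : ℕ) : Type := EuclideanSpace ℝ (Fin n) × (I × ℝ)

/-- The intensity measure `ν(dy) dx ds`. -/
def intensity {n : ℕ} (ν : Measure (EuclideanSpace ℝ (Fin n))) : Measure (StateSpace n) :=
  ν.prod (volume : Measure (I × ℝ))

/-- The `ℤⁿ`-valued Lévy basis `L(B) = ∫ y 1_B(x, s) N(dy, dx, ds)`, for `B ⊆ [0,1] × ℝ`. -/
def levyBasis {n : ℕ} {Ω : Type*} (N : Ω → Measure (StateSpace n)) (B : Set (I × ℝ)) (ω : Ω) :
    EuclideanSpace ℝ (Fin n) :=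
  ∫ p in Prod.snd ⁻¹' B, p.1 ∂(N ω)

/-- The random vector `L'` is a Lévy seed with Lévy measure `ν`:
its characteristic function is `exp (∫ (exp(i θᵀy) - 1) ν(dy))`. -/
structure IsLevySeed {n : ℕ} {Ω : Type*} [MeasurableSpace Ω] (L' : Ω → EuclideanSpace ℝ (Fin n))
    (ν : Measure (EuclideanSpace ℝ (Fin n))) (P : Measure Ω) : Prop where
  aemeasurable : AEMeasurable L' P
  charFun_eq : ∀ θ : EuclideanSpace ℝ (Fin n),
    charFun (P.map L') θ =
      Complex.exp (∫ y, (Complex.exp (Complex.I * ((∑ i, θ i * y i : ℝ) : ℂ)) - 1) ∂ν)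

/-- The sub-vector `(y_i)_{i ∈ S}`. -/
def subvector {n : ℕ} (S : Finset (Fin n)) (y : EuclideanSpace ℝ (Fin n)) : EuclideanSpace ℝ S :=
  WithLp.toLp 2 fun i => y i

/-! ### Trawls and the trawl process -/

/-- A trawl: a Borel subset of `[0,1] × (-∞, 0]` of finite Lebesgue measure. -/
structure IsTrawl (A : Set (I × ℝ)) : Prop where
  measurableSet : MeasurableSet A
  subset : A ⊆ {p | p.2 ≤ 0}
  volume_lt_top : volume A < ∞

/-- The shifted trawl `A_t = A + (0, t)`. -/
def shift (A : Set (I × ℝ)) (t : ℝ) : Set (I × ℝ) := {p | (p.1, p.2 - t) ∈ A}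

/-- The multivariate integer-valued trawl process `Y_t = (L⁽¹⁾(A⁽¹⁾_t), …, L⁽ⁿ⁾(A⁽ⁿ⁾_t))`. -/
def trawlProcess {n : ℕ} {Ω : Type*} (N : Ω → Measure (StateSpace n)) (A : Fin n → Set (I × ℝ))
    (t : ℝ) (ω : Ω) : EuclideanSpace ℝ (Fin n) :=
  WithLp.toLp 2 fun i => levyBasis N (shift (A i) t) ω i

/-- The points lying in exactly the trawls `A⁽ⁱ⁾` with `i ∈ S` (for nonempty `S`). -/
def exactRegion {n : ℕ} (A : Fin n → Set (I × ℝ)) (S : Finset (Fin n)) : Set (I × ℝ) :=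
  (⋂ i ∈ S, A i) \ ⋃ j ∈ Sᶜ, A j

end Trawl

end

/-! A nonzero integer vector has norm at least 1, so `ν` is a finite measure and the intensity is
finite over the union of the trawls. There the process is one Poisson integral of the vector `(y_i
1_{A_i}(x, s))_i`, and this integrand is constant on the countably many disjoint cells `{y} ×
trawlCell A S`.

The masses of the cells are independent Poisson variables. Multiplying their characteristic
functions and passing to the limit gives `exp ∫ (exp(i⟨g, θ⟩) - 1) dμ`
(`integral_exp_inner_setIntegral`). On the atom of `S` only the coordinates in `S` survive, so by
Fubini the exponent is the sum over `S` of the atom's volume times the Lévy exponent at `θ` zeroed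
outside `S` (`integral_exp_inner_trawlIntegrand`), that is, the cumulant of the sub-vector of the
seed. The exponent is continuous and vanishes at 0, so by uniqueness it is the distinguished
logarithm; translation invariance removes `t`. -/

namespace Trawl

open Filter Topology Set Function

/-! ### Poisson random measures on countably many disjoint cells. -/

section PoissonRandomMeasure

variable {E Ω : Type*} [MeasurableSpace E] [MeasurableSpace Ω] {N : Ω → Measure E}
  {μ : Measure E} {P : Measure Ω}

theorem IsPoissonRandomMeasure.ae_exists_nat (hN : IsPoissonRandomMeasure N μ P) {B : Set E}
    (hB : MeasurableSet B) (hμ : μ B < ∞) : ∀ᵐ ω ∂P, ∃ k : ℕ, N ω B = k := by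
  have hlaw := hN.law_of_lt_top B hB hμ
  have hm : MeasurableSet (range fun k : ℕ => (k : ℝ≥0∞)) := (countable_range _).measurableSet
  have h : ∀ᵐ x ∂(P.map fun ω => N ω B), x ∈ range fun k : ℕ => (k : ℝ≥0∞) := by
    rw [hlaw, ae_map_iff (p := fun x => x ∈ range fun k : ℕ => (k : ℝ≥0∞))
      Measurable.of_discrete.aemeasurable hm]
    exact Eventually.of_forall fun k => ⟨k, rfl⟩
  filter_upwards [ae_of_ae_map (hN.measurable_eval B hB).aemeasurable h] with ω ⟨k, hk⟩
  exact ⟨k, hk.symm⟩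

theorem IsPoissonRandomMeasure.ae_lt_top (hN : IsPoissonRandomMeasure N μ P) {B : Set E}
    (hB : MeasurableSet B) (hμ : μ B < ∞) : ∀ᵐ ω ∂P, N ω B < ∞ := by
  filter_upwards [hN.ae_exists_nat hB hμ] with ω ⟨k, hk⟩
  simp [hk]

theorem IsPoissonRandomMeasure.ae_eq_zero (hN : IsPoissonRandomMeasure N μ P) {B : Set E}
    (hB : MeasurableSet B) (hμ : μ B = 0) : ∀ᵐ ω ∂P, N ω B = 0 := by
  have hlaw := hN.law_of_lt_top B hB (by simp [hμ])
  have h : ∀ᵐ x ∂(P.map fun ω => N ω B), x ∈ ({0} : Set ℝ≥0∞) := by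
    rw [hlaw, ae_map_iff (p := fun x => x ∈ ({0} : Set ℝ≥0∞)) Measurable.of_discrete.aemeasurable
      (measurableSet_singleton 0), hμ,
      ae_iff_of_countable]
    intro k hk
    -- The Poisson law of rate 0 gives no weight to a positive integer.
    rcases k with _ | k
    · simp
    · exact absurd (by simp [poissonMeasure_singleton]) hk
  filter_upwards [ae_of_ae_map (hN.measurable_eval B hB).aemeasurable h] with ω hω
  simpa using hω

theorem IsPoissonRandomMeasure.integral_exp (hN : IsPoissonRandomMeasure N μ P) {B : Set E}
    (hB : MeasurableSet B) (hμ : μ B < ∞) (c : ℝ) :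
    ∫ ω, Complex.exp (((N ω).real B * c : ℝ) * Complex.I) ∂P =
      Complex.exp (μ.real B * (Complex.exp (c * Complex.I) - 1)) := by
  have h := charFun_map_cast_poissonMeasure (μ B).toNNReal c
  rw [charFun_apply_real, integral_map Measurable.of_discrete.aemeasurable (by fun_prop)] at h
  have hf : Measurable fun x : ℝ≥0∞ => Complex.exp ((x.toReal * c : ℝ) * Complex.I) := by fun_prop
  have h2 := integral_map (μ := P) (hN.measurable_eval B hB).aemeasurable hf.aestronglyMeasurable
  simp only [Measure.real]
  rw [← h2, hN.law_of_lt_top B hB hμ,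
    integral_map Measurable.of_discrete.aemeasurable hf.aestronglyMeasurable]
  convert h using 3 with k
  · simp [mul_comm]
  · rfl

theorem IsPoissonRandomMeasure.integral_exp_sum (hN : IsPoissonRandomMeasure N μ P)
    {K : Type*} {B : K → Set E} (hB : ∀ k, MeasurableSet (B k)) (hd : Pairwise (Disjoint on B))
    (hμ : ∀ k, μ (B k) < ∞) (c : K → ℝ) (s : Finset K) :
    ∫ ω, Complex.exp ((∑ k ∈ s, (N ω).real (B k) * c k : ℝ) * Complex.I) ∂P =
      Complex.exp (∑ k ∈ s, μ.real (B k) * (Complex.exp (c k * Complex.I) - 1)) := by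
  -- Independence is available for families indexed by `Fin m`, hence the reindexing.
  let e := s.equivFin.symm
  have hind := hN.indep s.card (fun i => B (e i)) (fun i => hB _) (fun i j hij =>
    hd (fun h => hij (e.injective (Subtype.ext h))))
  have hind' := hind.comp (fun i x => Complex.exp ((x.toReal * c (e i) : ℝ) * Complex.I))
    (fun i => by fun_prop)
  have hprod := hind'.integral_fun_prod_eq_prod_integral (fun i => by
    refine Measurable.aestronglyMeasurable ?_
    exact Measurable.comp (by fun_prop) (hN.measurable_eval _ (hB _)))
  rw [Complex.exp_sum]
  simp only [← hN.integral_exp (hB _) (hμ _)]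
  rw [← Finset.prod_coe_sort, ← e.prod_comp]
  refine Eq.trans (integral_congr_ae (Eventually.of_forall fun ω => ?_)) hprod
  simp only [comp_apply]
  rw [← Complex.exp_sum, ← Finset.sum_coe_sort, ← e.sum_comp, Complex.ofReal_sum, Finset.sum_mul]
  rfl

variable {F : Type*} [NormedAddCommGroup F]

/-- The total mass is finite and every cell has integer mass, so almost surely only finitely many
cells are charged. No bound on the values `c k` is needed. -/
theorem IsPoissonRandomMeasure.ae_integrableOn_iUnion (hN : IsPoissonRandomMeasure N μ P)
    {K : Type*} [Countable K] {B : K → Set E} (hB : ∀ k, MeasurableSet (B k))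
    (hd : Pairwise (Disjoint on B)) (hμ : μ (⋃ k, B k) < ∞) {g : E → F} {c : K → F}
    (hg : ∀ k, ∀ p ∈ B k, g p = c k) : ∀ᵐ ω ∂P, IntegrableOn g (⋃ k, B k) (N ω) := by
  have hμ' : ∀ k, μ (B k) < ∞ := fun k => (measure_mono (subset_iUnion _ _)).trans_lt hμ
  filter_upwards [hN.ae_lt_top (MeasurableSet.iUnion hB) hμ,
    ae_all_iff.2 fun k => hN.ae_exists_nat (hB k) (hμ' k)] with ω hfin hnat
  have hfin' : ∀ k, N ω (B k) < ∞ := fun k => (measure_mono (subset_iUnion _ _)).trans_lt hfin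
  refine integrableOn_iUnion_of_summable_integral_norm (fun k => ?_) ?_
  · exact (integrableOn_const (C := c k) (hfin' k).ne).congr_fun
      (fun p hp => (hg k p hp).symm) (hB k)
  · have hsupp : {k | 1 ≤ N ω (B k)}.Finite := by
      refine ENNReal.finite_const_le_of_tsum_ne_top ?_ one_ne_zero
      rw [← measure_iUnion hd hB]
      exact hfin.ne
    refine summable_of_hasFiniteSupport (hsupp.subset fun k hk => ?_)
    -- An integer mass is 0, making the integral vanish, or at least 1.
    obtain ⟨m, hm⟩ := hnat k
    simp only [mem_ofPred_eq, hm]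
    rcases m with _ | m
    · exact absurd (setIntegral_measure_zero _ (by simpa using hm)) hk
    · simp

theorem hasSum_setIntegral_of_const [NormedSpace ℝ F] [CompleteSpace F] {m : Measure E} {K : Type*} [Countable K]
    {B : K → Set E} (hB : ∀ k, MeasurableSet (B k)) (hd : Pairwise (Disjoint on B))
    {g : E → F} {c : K → F} (hg : ∀ k, ∀ p ∈ B k, g p = c k)
    (hi : IntegrableOn g (⋃ k, B k) m) :
    HasSum (fun k => m.real (B k) • c k) (∫ p in ⋃ k, B k, g p ∂m) := by
  convert hasSum_integral_iUnion hB hd hi with k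
  rw [setIntegral_congr_fun (hB k) (hg k), setIntegral_const]

end PoissonRandomMeasure

/-! ### Measurability and characteristic functions of Poisson integrals. -/

section CharFun

variable {E Ω : Type*} [MeasurableSpace E] [MeasurableSpace Ω] {N : Ω → Measure E}
  {μ : Measure E} {P : Measure Ω} {F : Type*} [NormedAddCommGroup F] [InnerProductSpace ℝ F]
  [CompleteSpace F]

theorem IsPoissonRandomMeasure.aemeasurable_setIntegral [MeasurableSpace F] [BorelSpace F]
    [SecondCountableTopology F] (hN : IsPoissonRandomMeasure N μ P)
    {K : Type*} [Countable K] {B : K → Set E} (hB : ∀ k, MeasurableSet (B k))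
    (hd : Pairwise (Disjoint on B)) (hμ : μ (⋃ k, B k) < ∞) {g : E → F} {c : K → F}
    (hg : ∀ k, ∀ p ∈ B k, g p = c k) :
    AEMeasurable (fun ω => ∫ p in ⋃ k, B k, g p ∂(N ω)) P := by
  refine aemeasurable_of_tendsto_metrizable_ae (atTop : Filter (Finset K))
    (f := fun s ω => ∑ k ∈ s, (N ω).real (B k) • c k) (fun s => ?_) ?_
  · refine Measurable.aemeasurable (Finset.measurable_fun_sum _ fun k _ => ?_)
    exact ((hN.measurable_eval _ (hB k)).ennreal_toReal).smul_const _
  · filter_upwards [hN.ae_integrableOn_iUnion hB hd hμ hg] with ω hω using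
       hasSum_setIntegral_of_const hB hd hg hω

/-- Both sides are limits, along finite sets of cells, of the identity `integral_exp_sum`: the left
by dominated convergence (unimodular integrands), the right by continuity of `exp`. -/
theorem IsPoissonRandomMeasure.integral_exp_inner_setIntegral [IsProbabilityMeasure P]
    (hN : IsPoissonRandomMeasure N μ P)
    {K : Type*} [Countable K] {B : K → Set E} (hB : ∀ k, MeasurableSet (B k))
    (hd : Pairwise (Disjoint on B)) (hμ : μ (⋃ k, B k) < ∞) {g : E → F} {c : K → F}
    (hg : ∀ k, ∀ p ∈ B k, g p = c k) (θ : F) :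
    ∫ ω, Complex.exp ((inner ℝ (∫ p in ⋃ k, B k, g p ∂(N ω)) θ : ℝ) * Complex.I) ∂P =
      Complex.exp (∫ p in ⋃ k, B k,
        (Complex.exp ((inner ℝ (g p) θ : ℝ) * Complex.I) - 1) ∂μ) := by
  have hμ' : ∀ k, μ (B k) < ∞ := fun k => (measure_mono (subset_iUnion _ _)).trans_lt hμ
  have hsum : HasSum
      (fun k => (μ.real (B k) : ℂ) * (Complex.exp ((inner ℝ (c k) θ : ℝ) * Complex.I) - 1))
      (∫ p in ⋃ k, B k, (Complex.exp ((inner ℝ (g p) θ : ℝ) * Complex.I) - 1) ∂μ) := by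
    have hg' : ∀ k, ∀ p ∈ B k, Complex.exp ((inner ℝ (g p) θ : ℝ) * Complex.I) - 1 =
        Complex.exp ((inner ℝ (c k) θ : ℝ) * Complex.I) - 1 := fun k p hp => by rw [hg k p hp]
    have hi : IntegrableOn (fun p => Complex.exp ((inner ℝ (g p) θ : ℝ) * Complex.I) - 1)
        (⋃ k, B k) μ := by
      -- The bound 2 is `|exp(ix)| + 1`; it suffices since `μ` is finite on the union.
      refine IntegrableOn.of_bound hμ ?_ 2 (Eventually.of_forall fun p => ?_)
      · rw [aestronglyMeasurable_iUnion_iff]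
        refine fun k => aestronglyMeasurable_const.congr
          ((ae_restrict_iff' (hB k)).2 (Eventually.of_forall fun p hp => (hg' k p hp).symm))
      · refine (norm_sub_le _ _).trans ?_
        rw [Complex.norm_exp_ofReal_mul_I]
        norm_num
    simpa [Complex.real_smul] using hasSum_setIntegral_of_const hB hd hg' hi
  have hlim := (Complex.continuous_exp.tendsto _).comp hsum
  have heq : ∀ s : Finset K,
      Complex.exp (∑ k ∈ s,
        (μ.real (B k) : ℂ) * (Complex.exp ((inner ℝ (c k) θ : ℝ) * Complex.I) - 1)) =
      ∫ ω, Complex.exp ((∑ k ∈ s, (N ω).real (B k) * inner ℝ (c k) θ : ℝ) * Complex.I) ∂P :=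
    fun s => (hN.integral_exp_sum hB hd hμ' (fun k => inner ℝ (c k) θ) s).symm
  refine tendsto_nhds_unique (f := fun s : Finset K =>
    ∫ ω, Complex.exp ((∑ k ∈ s, (N ω).real (B k) * inner ℝ (c k) θ : ℝ) * Complex.I) ∂P)
    ?_ (hlim.congr heq)
  refine tendsto_integral_filter_of_dominated_convergence (fun _ => 1)
    (Eventually.of_forall fun s => ?_) (Eventually.of_forall fun s => ?_)
    (integrable_const _) ?_
  · refine Measurable.aestronglyMeasurable ?_
    have : Measurable fun ω => ∑ k ∈ s, (N ω).real (B k) * inner ℝ (c k) θ :=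
      Finset.measurable_fun_sum _ fun k _ =>
        ((hN.measurable_eval _ (hB k)).ennreal_toReal).mul_const _
    fun_prop
  · exact Eventually.of_forall fun ω => (Complex.norm_exp_ofReal_mul_I _).le
  · filter_upwards [hN.ae_integrableOn_iUnion hB hd hμ hg] with ω hω
    have h1 := hasSum_setIntegral_of_const hB hd hg hω
    have h2 : Continuous fun x : F => Complex.exp ((inner ℝ x θ : ℝ) * Complex.I) := by fun_prop
    refine ((h2.tendsto _).comp h1).congr fun s => ?_
    simp only [comp_apply, sum_inner, real_inner_smul_left]

end CharFun

variable {n : ℕ}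

/-! ### Integer Lévy measures -/

theorem IsIntegerLevyMeasure.isFiniteMeasure {ν : Measure (EuclideanSpace ℝ (Fin n))}
    (hν : IsIntegerLevyMeasure ν) : IsFiniteMeasure ν := by
  refine ⟨lt_of_le_of_lt ?_ hν.lintegral_lt_top⟩
  rw [← lintegral_one]
  refine lintegral_mono_ae ?_
  have h : ∀ᵐ y ∂ν, y ≠ 0 ∧ ∀ i, ∃ k : ℤ, y i = (k : ℝ) := hν.concentrated
  filter_upwards [h] with y ⟨hy, hint⟩
  obtain ⟨i, hi⟩ : ∃ i, y i ≠ 0 := by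
    by_contra! h0
    exact hy (PiLp.ext h0)
  obtain ⟨k, hk⟩ := hint i
  have hk0 : k ≠ 0 := fun h0 => hi (by simp [hk, h0])
  have h1 : (1 : ℝ) ≤ ‖y i‖ := by
    rw [hk, Real.norm_eq_abs]
    exact_mod_cast Int.one_le_abs hk0
  rw [min_eq_left (h1.trans (PiLp.norm_apply_le y i)), ENNReal.ofReal_one]

/-- The inclusion of `ℤⁿ` in `ℝⁿ`. -/
def latticePoint (y : Fin n → ℤ) : EuclideanSpace ℝ (Fin n) := WithLp.toLp 2 fun i => (y i : ℝ)

theorem latticePoint_injective : Injective (latticePoint (n := n)) := fun y z h => by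
  funext i
  have := congrArg (fun x : EuclideanSpace ℝ (Fin n) => x i) h
  simpa [latticePoint] using this

theorem measurableSet_range_latticePoint : MeasurableSet (range (latticePoint (n := n))) :=
  (countable_range _).measurableSet

theorem IsIntegerLevyMeasure.measure_compl_range {ν : Measure (EuclideanSpace ℝ (Fin n))}
    (hν : IsIntegerLevyMeasure ν) : ν (range latticePoint)ᶜ = 0 := by
  refine measure_mono_null (compl_subset_compl.2 ?_) hν.concentrated
  rintro y ⟨-, hy⟩
  choose k hk using hy
  exact ⟨k, PiLp.ext fun i => (hk i).symm⟩

/-- The exponent `∫ (exp(i θᵀy) - 1) ν(dy)` of the Lévy seed. -/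
noncomputable def levyExponent (ν : Measure (EuclideanSpace ℝ (Fin n))) (θ : EuclideanSpace ℝ (Fin n)) : ℂ :=
  ∫ y, (Complex.exp (Complex.I * ((∑ i, θ i * y i : ℝ) : ℂ)) - 1) ∂ν

theorem norm_exp_I_mul_sub_one_le (x : ℝ) : ‖Complex.exp (Complex.I * x) - 1‖ ≤ 2 := by
  refine (norm_sub_le _ _).trans ?_
  rw [mul_comm, Complex.norm_exp_ofReal_mul_I]
  norm_num

theorem continuous_levyExponent (ν : Measure (EuclideanSpace ℝ (Fin n))) [IsFiniteMeasure ν] :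
    Continuous (levyExponent ν) := by
  refine continuous_of_dominated (bound := fun _ => 2) (fun θ => ?_)
    (fun θ => Eventually.of_forall fun y => norm_exp_I_mul_sub_one_le _) (integrable_const _)
    (Eventually.of_forall fun y => by fun_prop)
  exact Continuous.aestronglyMeasurable (by fun_prop)

theorem levyExponent_zero (ν : Measure (EuclideanSpace ℝ (Fin n))) : levyExponent ν 0 = 0 := by
  simp [levyExponent]

/-! ### The Lévy seed -/

/-- The extension by zero of a vector indexed by `S`. -/
def extendZero (S : Finset (Fin n)) (θ : EuclideanSpace ℝ S) : EuclideanSpace ℝ (Fin n) :=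
  WithLp.toLp 2 fun i => if h : i ∈ S then θ ⟨i, h⟩ else 0

theorem continuous_extendZero (S : Finset (Fin n)) : Continuous (extendZero S) := by
  refine (PiLp.continuous_toLp 2 _).comp (continuous_pi fun i => ?_)
  by_cases h : i ∈ S
  · simp only [h, dif_pos]; fun_prop
  · simp only [h, dif_neg, not_false_eq_true]; fun_prop

theorem extendZero_zero (S : Finset (Fin n)) : extendZero S 0 = 0 := by
  ext i
  simp [extendZero]

theorem extendZero_subvector_apply (S : Finset (Fin n)) (θ : EuclideanSpace ℝ (Fin n))
    (i : Fin n) : extendZero S (subvector S θ) i = if i ∈ S then θ i else 0 := by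
  simp [extendZero, subvector]

theorem continuous_subvector (S : Finset (Fin n)) : Continuous (subvector S) :=
  (PiLp.continuous_toLp 2 _).comp (continuous_pi fun i => by fun_prop)

/-- Extension by zero is the adjoint of restriction to `S`; marginal characteristic functions follow
from this. -/
theorem inner_subvector (S : Finset (Fin n)) (y : EuclideanSpace ℝ (Fin n))
    (θ : EuclideanSpace ℝ S) : inner ℝ (subvector S y) θ = inner ℝ y (extendZero S θ) := by
  simp only [PiLp.inner_apply]
  have h0 : ∀ i ∈ Finset.univ, i ∉ S → inner ℝ (y i) (extendZero S θ i) = 0 :=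
    fun i _ hi => by simp [extendZero, hi]
  refine Eq.trans ?_ (Finset.sum_subset (Finset.subset_univ S) h0)
  rw [← Finset.sum_coe_sort S]
  exact Finset.sum_congr rfl fun i _ => by simp [extendZero, subvector]

theorem charFun_map_subvector {Ω : Type*} [MeasurableSpace Ω] {P : Measure Ω}
    {X : Ω → EuclideanSpace ℝ (Fin n)} (hX : AEMeasurable X P) (S : Finset (Fin n))
    (θ : EuclideanSpace ℝ S) :
    charFun (P.map fun ω => subvector S (X ω)) θ = charFun (P.map X) (extendZero S θ) := by
  have hS := (continuous_subvector S).measurable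
  rw [charFun_apply, charFun_apply, integral_map
    (φ := fun ω => subvector S (X ω)) (hS.comp_aemeasurable hX)
    (Continuous.aestronglyMeasurable (by fun_prop)), integral_map hX
    (Continuous.aestronglyMeasurable (by fun_prop))]
  simp only [inner_subvector]

theorem IsLevySeed.isCumulantFunction_subvector {ν : Measure (EuclideanSpace ℝ (Fin n))}
    [IsFiniteMeasure ν] {Ω : Type*} [MeasurableSpace Ω] {P : Measure Ω}
    {L' : Ω → EuclideanSpace ℝ (Fin n)} (hL' : IsLevySeed L' ν P) (S : Finset (Fin n)) :
    IsCumulantFunction (P.map fun ω => subvector S (L' ω))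
      (fun θ => levyExponent ν (extendZero S θ)) where
  continuous := (continuous_levyExponent ν).comp (continuous_extendZero S)
  map_zero := by rw [extendZero_zero, levyExponent_zero]
  exp_eq θ := by
    rw [charFun_map_subvector hL'.aemeasurable, hL'.charFun_eq]
    rfl

/-! ### The partition generated by the trawls -/

/-- The atom of the partition of `⋃ i, A i` generated by the sets `A i` on which exactly the
sets `A i` with `i ∈ S` are active (empty for `S = ∅`). -/
def trawlCell (A : Fin n → Set (I × ℝ)) (S : Finset (Fin n)) : Set (I × ℝ) :=
  exactRegion A S ∩ ⋃ i, A i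

theorem mem_exactRegion {A : Fin n → Set (I × ℝ)} {S : Finset (Fin n)} {q : I × ℝ} :
    q ∈ exactRegion A S ↔ ∀ i, q ∈ A i ↔ i ∈ S := by
  simp only [exactRegion, Set.mem_sdiff, mem_iInter, mem_iUnion, Finset.mem_compl, not_exists]
  exact ⟨fun h i => ⟨fun hi => by_contra fun hS => h.2 i hS hi, h.1 i⟩,
    fun h => ⟨fun i => (h i).2, fun i hS hi => hS ((h i).1 hi)⟩⟩

/-- This is why cells are cut down to `⋃ i, A i`: `exactRegion A ∅` is the complement of all the
trawls, which has infinite volume when the trawls have finite volume. -/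
theorem trawlCell_empty (A : Fin n → Set (I × ℝ)) : trawlCell A ∅ = ∅ := by
  refine eq_empty_of_forall_notMem fun q ⟨h, hU⟩ => ?_
  obtain ⟨i, hi⟩ := mem_iUnion.1 hU
  simpa using (mem_exactRegion.1 h i).1 hi

theorem trawlCell_eq (A : Fin n → Set (I × ℝ)) {S : Finset (Fin n)} (hS : S.Nonempty) :
    trawlCell A S = exactRegion A S := by
  refine inter_eq_left.2 fun q hq => ?_
  obtain ⟨i, hi⟩ := hS
  exact mem_iUnion.2 ⟨i, (mem_exactRegion.1 hq i).2 hi⟩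

theorem pairwise_disjoint_trawlCell (A : Fin n → Set (I × ℝ)) :
    Pairwise (Disjoint on trawlCell A) := by
  refine fun S T hST => Set.disjoint_left.2 fun q hS hT => hST ?_
  ext i
  rw [← mem_exactRegion.1 hS.1 i, mem_exactRegion.1 hT.1 i]

theorem iUnion_trawlCell (A : Fin n → Set (I × ℝ)) : ⋃ S, trawlCell A S = ⋃ i, A i := by
  classical
  refine Subset.antisymm (iUnion_subset fun S => inter_subset_right) fun q hq => ?_
  exact mem_iUnion.2 ⟨Finset.univ.filter (fun i => q ∈ A i), mem_exactRegion.2 (by simp), hq⟩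

theorem measurableSet_trawlCell {A : Fin n → Set (I × ℝ)} (hA : ∀ i, MeasurableSet (A i))
    (S : Finset (Fin n)) : MeasurableSet (trawlCell A S) :=
  ((Finset.measurableSet_biInter _ fun i _ => hA i).diff
    (Finset.measurableSet_biUnion _ fun i _ => hA i)).inter (MeasurableSet.iUnion hA)

theorem volume_iUnion_lt_top {A : Fin n → Set (I × ℝ)} (hA : ∀ i, volume (A i) < ∞) :
    volume (⋃ i, A i) < ∞ :=
  (measure_iUnion_fintype_le _ _).trans_lt (ENNReal.sum_lt_top.2 fun i _ => hA i)

theorem volume_trawlCell_lt_top {A : Fin n → Set (I × ℝ)} (hA : ∀ i, volume (A i) < ∞)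
    (S : Finset (Fin n)) : volume (trawlCell A S) < ∞ :=
  (measure_mono inter_subset_right).trans_lt (volume_iUnion_lt_top hA)

theorem measurePreserving_shift (t : ℝ) :
    MeasurePreserving (fun p : I × ℝ => (p.1, p.2 - t)) volume volume :=
  (MeasurePreserving.id (volume : Measure I)).prod (measurePreserving_sub_right volume t)

theorem IsTrawl.measurableSet_shift {A : Set (I × ℝ)} (hA : IsTrawl A) (t : ℝ) :
    MeasurableSet (shift A t) :=
  (measurePreserving_shift t).measurable hA.measurableSet

theorem IsTrawl.volume_shift_lt_top {A : Set (I × ℝ)} (hA : IsTrawl A) (t : ℝ) :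
    volume (shift A t) < ∞ :=
  ((measurePreserving_shift t).measure_preimage hA.measurableSet.nullMeasurableSet).trans_lt
    hA.volume_lt_top

theorem volume_exactRegion_shift {A : Fin n → Set (I × ℝ)} (hA : ∀ i, MeasurableSet (A i))
    (S : Finset (Fin n)) (t : ℝ) :
    volume (exactRegion (fun i => shift (A i) t) S) = volume (exactRegion A S) := by
  have h : exactRegion (fun i => shift (A i) t) S =
      (fun p : I × ℝ => (p.1, p.2 - t)) ⁻¹' exactRegion A S := by
    ext q
    simp only [mem_exactRegion, mem_preimage]
    rfl
  rw [h, (measurePreserving_shift t).measure_preimage]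
  exact ((Finset.measurableSet_biInter _ fun i _ => hA i).diff
    (Finset.measurableSet_biUnion _ fun i _ => hA i)).nullMeasurableSet

/-! ### The trawl process as a Poisson integral -/

/-- The sets `{y} × trawlCell A S`, for `y ∈ ℤⁿ` and `S ⊆ {1, …, n}`. -/
def latticeCell (A : Fin n → Set (I × ℝ)) (k : (Fin n → ℤ) × Finset (Fin n)) :
    Set (StateSpace n) :=
  {latticePoint k.1} ×ˢ trawlCell A k.2

theorem measurableSet_latticeCell {A : Fin n → Set (I × ℝ)} (hA : ∀ i, MeasurableSet (A i))
    (k : (Fin n → ℤ) × Finset (Fin n)) : MeasurableSet (latticeCell A k) :=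
  (measurableSet_singleton _).prod (measurableSet_trawlCell hA _)

theorem pairwise_disjoint_latticeCell (A : Fin n → Set (I × ℝ)) :
    Pairwise (Disjoint on latticeCell A) := by
  rintro ⟨y, S⟩ ⟨z, T⟩ hne
  refine Set.disjoint_left.2 ?_
  rintro ⟨x, q⟩ ⟨h1, h2⟩ ⟨h3, h4⟩
  have hyz : y = z := latticePoint_injective ((eq_of_mem_singleton h1).symm.trans h3)
  have hST : S ≠ T := fun h => hne (by rw [hyz, h])
  exact Set.disjoint_left.1 (pairwise_disjoint_trawlCell A hST) h2 h4

theorem iUnion_latticeCell (A : Fin n → Set (I × ℝ)) :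
    ⋃ k, latticeCell A k = range latticePoint ×ˢ ⋃ i, A i := by
  rw [← iUnion_trawlCell A]
  ext ⟨y, q⟩
  simp [latticeCell, eq_comm]

/-- The integrand `(y_i 1_{A i}(x, s))_i` of the trawl process. -/
noncomputable def trawlIntegrand (A : Fin n → Set (I × ℝ)) (p : StateSpace n) :
    EuclideanSpace ℝ (Fin n) :=
  WithLp.toLp 2 fun i => (A i).indicator (fun _ => p.1 i) p.2

theorem measurable_trawlIntegrand {A : Fin n → Set (I × ℝ)} (hA : ∀ i, MeasurableSet (A i)) :
    Measurable (trawlIntegrand A) := by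
  refine (PiLp.continuous_toLp 2 _).measurable.comp (measurable_pi_lambda _ fun i => ?_)
  have h : (fun p : StateSpace n => (A i).indicator (fun _ => p.1 i) p.2) =
      (Prod.snd ⁻¹' A i).indicator fun p : StateSpace n => p.1 i := by
    rfl
  rw [h]
  exact Measurable.indicator (by fun_prop) (measurable_snd (hA i))

theorem inner_trawlIntegrand {A : Fin n → Set (I × ℝ)} {S : Finset (Fin n)} {p : StateSpace n}
    (hp : p.2 ∈ trawlCell A S) (θ : EuclideanSpace ℝ (Fin n)) :
    inner ℝ (trawlIntegrand A p) θ = ∑ i, extendZero S (subvector S θ) i * p.1 i := by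
  rw [PiLp.inner_apply]
  refine Finset.sum_congr rfl fun i _ => ?_
  rw [extendZero_subvector_apply]
  by_cases hi : i ∈ S
  · simp [trawlIntegrand, (mem_exactRegion.1 hp.1 i).2 hi, hi]
  · simp [trawlIntegrand, mt (mem_exactRegion.1 hp.1 i).1 hi, hi]

/-- Provides the constancy on cells that the general Poisson integral results require. -/
theorem trawlIntegrand_eq {A : Fin n → Set (I × ℝ)} (k : (Fin n → ℤ) × Finset (Fin n))
    (p : StateSpace n) (hp : p ∈ latticeCell A k) :
    trawlIntegrand A p = extendZero k.2 (subvector k.2 (latticePoint k.1)) := by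
  ext i
  rw [extendZero_subvector_apply]
  by_cases hi : i ∈ k.2
  · simp [trawlIntegrand, (mem_exactRegion.1 hp.2.1 i).2 hi, hi, eq_of_mem_singleton hp.1]
  · simp [trawlIntegrand, mt (mem_exactRegion.1 hp.2.1 i).1 hi, hi]

theorem intensity_iUnion_latticeCell_lt_top {ν : Measure (EuclideanSpace ℝ (Fin n))}
    [IsFiniteMeasure ν] {A : Fin n → Set (I × ℝ)} (hA : ∀ i, volume (A i) < ∞) :
    intensity ν (⋃ k, latticeCell A k) < ∞ := by
  rw [iUnion_latticeCell, intensity, Measure.prod_prod]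
  exact ENNReal.mul_lt_top (measure_lt_top _ _) (volume_iUnion_lt_top hA)

theorem IsIntegerLevyMeasure.intensity_eq_zero {ν : Measure (EuclideanSpace ℝ (Fin n))}
    (hν : IsIntegerLevyMeasure ν) :
    intensity ν (Prod.fst ⁻¹' (range latticePoint)ᶜ) = 0 := by
  have := hν.isFiniteMeasure
  rw [← prod_univ, intensity, Measure.prod_prod, hν.measure_compl_range, zero_mul]

/-- Stated for a general `m` so as to serve both for the intensity and for almost every realisation
`N ω`. -/
theorem latticeCell_ae_eq {m : Measure (StateSpace n)}
    (hm : m (Prod.fst ⁻¹' (range latticePoint)ᶜ) = 0) (A : Fin n → Set (I × ℝ)) :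
    (⋃ k, latticeCell A k : Set (StateSpace n)) =ᵐ[m] Prod.snd ⁻¹' ⋃ i, A i := by
  have h : ∀ᵐ p ∂m, p.1 ∈ range latticePoint := hm
  rw [iUnion_latticeCell]
  filter_upwards [h] with p hp
  exact propext ⟨fun h => h.2, fun h => ⟨hp, h⟩⟩

/-- Coordinate projections commute with Bochner integrals of integrable functions, so `n` integrals
over different sets merge into one vector integral. Integrability is essential, as a divergent
integral has the default value 0. -/
theorem trawlProcess_eq_setIntegral {Ω : Type*} {N : Ω → Measure (StateSpace n)}
    {A : Fin n → Set (I × ℝ)} {t : ℝ} {ω : Ω}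
    (hω : N ω (Prod.fst ⁻¹' (range latticePoint)ᶜ) = 0)
    (hi : IntegrableOn (fun p : StateSpace n => p.1) (Prod.snd ⁻¹' ⋃ i, shift (A i) t) (N ω))
    (hAt : ∀ i, MeasurableSet (shift (A i) t)) :
    trawlProcess N A t ω =
      ∫ p in ⋃ k, latticeCell (fun i => shift (A i) t) k,
        trawlIntegrand (fun i => shift (A i) t) p ∂(N ω) := by
  rw [setIntegral_congr_set (latticeCell_ae_eq hω _)]
  have hsub : ∀ i, Prod.snd ⁻¹' shift (A i) t ⊆
      (Prod.snd ⁻¹' ⋃ i, shift (A i) t : Set (StateSpace n)) :=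
    fun i => preimage_mono (subset_iUnion (fun i => shift (A i) t) i)
  have hcoord : ∀ i p, trawlIntegrand (fun i => shift (A i) t) p i =
      (Prod.snd ⁻¹' shift (A i) t).indicator (fun p : StateSpace n => p.1 i) p := fun i p => rfl
  have hproj : ∀ i, IntegrableOn (fun p : StateSpace n => p.1 i)
      (Prod.snd ⁻¹' ⋃ i, shift (A i) t) (N ω) := fun i =>
    (EuclideanSpace.proj (𝕜 := ℝ) i).integrable_comp hi
  have hint : IntegrableOn (trawlIntegrand (fun i => shift (A i) t))
      (Prod.snd ⁻¹' ⋃ i, shift (A i) t) (N ω) := by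
    refine Integrable.of_eval_piLp fun i => ?_
    simp only [hcoord]
    exact (hproj i).indicator (measurable_snd (hAt i))
  ext i
  have h1 := (EuclideanSpace.proj (𝕜 := ℝ) i).integral_comp_comm (hi.mono_set (hsub i))
  have h2 := (EuclideanSpace.proj (𝕜 := ℝ) i).integral_comp_comm hint
  simp only [PiLp.proj_apply] at h1 h2
  change (∫ p in Prod.snd ⁻¹' shift (A i) t, p.1 ∂(N ω)) i = _
  rw [← h2, ← h1]
  simp only [hcoord]
  rw [setIntegral_indicator (measurable_snd (hAt i)), inter_eq_right.2 (hsub i)]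

theorem integral_exp_inner_trawlIntegrand {ν : Measure (EuclideanSpace ℝ (Fin n))}
    (hν : IsIntegerLevyMeasure ν) {A : Fin n → Set (I × ℝ)} (hA : ∀ i, MeasurableSet (A i))
    (hvol : ∀ i, volume (A i) < ∞) (θ : EuclideanSpace ℝ (Fin n)) :
    ∫ p in ⋃ k, latticeCell A k,
        (Complex.exp ((inner ℝ (trawlIntegrand A p) θ : ℝ) * Complex.I) - 1) ∂(intensity ν) =
      ∑ S, ((volume (trawlCell A S)).toReal : ℂ) *
        levyExponent ν (extendZero S (subvector S θ)) := by
  have := hν.isFiniteMeasure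
  have hpre : (Prod.snd ⁻¹' ⋃ i, A i : Set (StateSpace n)) =
      ⋃ S, univ ×ˢ trawlCell A S := by
    rw [← iUnion_trawlCell, preimage_iUnion]
    simp only [univ_prod]
  have hm : ∀ S, MeasurableSet (univ ×ˢ trawlCell A S : Set (StateSpace n)) := fun S =>
    MeasurableSet.univ.prod (measurableSet_trawlCell hA S)
  rw [setIntegral_congr_set (latticeCell_ae_eq hν.intensity_eq_zero _), hpre,
    integral_iUnion_fintype hm]
  · refine Finset.sum_congr rfl fun S _ => ?_
    -- On the cell of `S` the integrand depends on `y` alone, so it is a product with the constant 1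
    -- in `(x, s)`.
    have h := setIntegral_prod_mul (μ := ν) (ν := (volume : Measure (I × ℝ)))
      (fun y => Complex.exp (Complex.I *
        ((∑ i, extendZero S (subvector S θ) i * y i : ℝ) : ℂ)) - 1) (fun _ => 1) univ
      (trawlCell A S)
    rw [setIntegral_univ, setIntegral_const] at h
    rw [mul_comm, levyExponent]
    refine Eq.trans ?_ (h.trans (by simp [Measure.real]))
    refine setIntegral_congr_fun (hm S) fun p hp => ?_
    simp only [inner_trawlIntegrand hp.2, mul_one]
    rw [mul_comm]
  · exact fun S T hST => Set.disjoint_prod.2 (Or.inr (pairwise_disjoint_trawlCell A hST))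
  · intro S
    refine IntegrableOn.of_bound ?_ ?_ 2 (Eventually.of_forall fun p => ?_)
    · rw [intensity, Measure.prod_prod]
      exact ENNReal.mul_lt_top (measure_lt_top _ _) (volume_trawlCell_lt_top hvol S)
    · have := measurable_trawlIntegrand hA
      exact Measurable.aestronglyMeasurable (by fun_prop)
    · rw [mul_comm]
      exact norm_exp_I_mul_sub_one_le _

/-- Groups subsets by cardinality. The two summands need agree only on nonempty sets, since the sum
over `k` starts at 1 and `f ∅ = 0`. -/
theorem sum_powersetCard_eq_sum {f g : Finset (Fin n) → ℂ} (hf : f ∅ = 0)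
    (hfg : ∀ S : Finset (Fin n), S.Nonempty → g S = f S) :
    ∑ k ∈ Finset.Icc 1 n, ∑ S ∈ Finset.powersetCard k (Finset.univ : Finset (Fin n)), g S =
      ∑ S, f S := by
  rw [← Finset.powerset_univ, Finset.sum_powerset, Finset.card_univ, Fintype.card_fin,
    Finset.sum_range_succ', Finset.powersetCard_zero, Finset.sum_singleton, hf, add_zero,
    Finset.range_eq_Ico, Finset.sum_Ico_add' (fun k => ∑ S ∈ Finset.powersetCard k
      (Finset.univ : Finset (Fin n)), f S) 0 n 1, zero_add]
  refine Finset.sum_congr (by ext; simp) fun k hk => Finset.sum_congr rfl fun S hS => ?_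
  refine hfg S (Finset.card_pos.1 ?_)
  rw [(Finset.mem_powersetCard.1 hS).2]
  exact (Finset.mem_Ico.1 hk).1

end Trawl

/-! ### The cumulant formula. -/

theorem mainTheorem1 {n : ℕ} (ν : Measure (EuclideanSpace ℝ (Fin n)))
    (hν : Trawl.IsIntegerLevyMeasure ν)
    {Ω : Type*} [MeasurableSpace Ω] (P : Measure Ω) [IsProbabilityMeasure P]
    (N : Ω → Measure (Trawl.StateSpace n))
    (hN : Trawl.IsPoissonRandomMeasure N (Trawl.intensity ν) P)
    {Ω' : Type*} [MeasurableSpace Ω'] (P' : Measure Ω') [IsProbabilityMeasure P']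
    (L' : Ω' → EuclideanSpace ℝ (Fin n)) (hL' : Trawl.IsLevySeed L' ν P')
    (A : Fin n → Set (I × ℝ)) (hA : ∀ i, Trawl.IsTrawl (A i)) (t : ℝ) :
    -- the integrals defining the trawl process exist, and the process is a random vector
    (∀ i, ∀ᵐ ω ∂P, IntegrableOn (fun p : Trawl.StateSpace n => p.1)
      (Prod.snd ⁻¹' Trawl.shift (A i) t) (N ω)) ∧
    AEMeasurable (Trawl.trawlProcess N A t) P ∧
    -- the cumulant functions of the sub-vectors of the Lévy seed and of the process exist
    (∀ S : Finset (Fin n),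
      Trawl.IsCumulantFunction (P'.map fun ω => Trawl.subvector S (L' ω))
        (Trawl.cumulantFunction (P'.map fun ω => Trawl.subvector S (L' ω)))) ∧
    Trawl.IsCumulantFunction (P.map (Trawl.trawlProcess N A t))
      (Trawl.cumulantFunction (P.map (Trawl.trawlProcess N A t))) ∧
    ∀ θ : EuclideanSpace ℝ (Fin n),
      ∫ ω, Complex.exp (Complex.I * ((∑ i, θ i * Trawl.trawlProcess N A t ω i : ℝ) : ℂ)) ∂P =
        Complex.exp (Trawl.cumulantFunction (P.map (Trawl.trawlProcess N A t)) θ) ∧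
      Trawl.cumulantFunction (P.map (Trawl.trawlProcess N A t)) θ =
        ∑ k ∈ Finset.Icc 1 n, ∑ S ∈ Finset.powersetCard k (Finset.univ : Finset (Fin n)),
          ((volume (Trawl.exactRegion A S)).toReal : ℂ) *
            Trawl.cumulantFunction (P'.map fun ω => Trawl.subvector S (L' ω))
              (Trawl.subvector S θ) := by
  have := hν.isFiniteMeasure
  have hAt : ∀ i, MeasurableSet (Trawl.shift (A i) t) := fun i => (hA i).measurableSet_shift t
  have hvol : ∀ i, volume (Trawl.shift (A i) t) < ∞ := fun i => (hA i).volume_shift_lt_top t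
  have hB := Trawl.measurableSet_latticeCell hAt
  have hd := Trawl.pairwise_disjoint_latticeCell fun i => Trawl.shift (A i) t
  have hμ := Trawl.intensity_iUnion_latticeCell_lt_top (ν := ν) hvol
  have hnull : ∀ᵐ ω ∂P, N ω (Prod.fst ⁻¹' (Set.range Trawl.latticePoint)ᶜ) = 0 :=
    hN.ae_eq_zero (measurable_fst Trawl.measurableSet_range_latticePoint.compl) hν.intensity_eq_zero
  have hint : ∀ᵐ ω ∂P, IntegrableOn (fun p : Trawl.StateSpace n => p.1)
      (Prod.snd ⁻¹' ⋃ i, Trawl.shift (A i) t) (N ω) := by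
    -- The mark `y` is itself constant on each cell, so it is integrable there; `N ω` ignores marks
    -- off the lattice.
    filter_upwards [hnull, hN.ae_integrableOn_iUnion hB hd hμ (g := Prod.fst)
      (c := fun k => Trawl.latticePoint k.1) fun k p hp => hp.1] with ω hω hω'
    exact hω'.congr_set_ae (Trawl.latticeCell_ae_eq hω _).symm
  have hY : Trawl.trawlProcess N A t =ᵐ[P] fun ω =>
      ∫ p in ⋃ k, Trawl.latticeCell (fun i => Trawl.shift (A i) t) k,
        Trawl.trawlIntegrand (fun i => Trawl.shift (A i) t) p ∂(N ω) := by
    filter_upwards [hnull, hint] with ω h1 h2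
    exact Trawl.trawlProcess_eq_setIntegral h1 h2 hAt
  have hmeas : AEMeasurable (Trawl.trawlProcess N A t) P :=
    (hN.aemeasurable_setIntegral hB hd hμ Trawl.trawlIntegrand_eq).congr hY.symm
  have hchar : ∀ θ, charFun (P.map (Trawl.trawlProcess N A t)) θ =
      Complex.exp (∑ S, ((volume (Trawl.trawlCell (fun i => Trawl.shift (A i) t) S)).toReal : ℂ) *
        Trawl.levyExponent ν (Trawl.extendZero S (Trawl.subvector S θ))) := fun θ => by
    rw [charFun_apply, Measure.map_congr hY, integral_map (hmeas.congr hY)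
      (Continuous.aestronglyMeasurable (by fun_prop)),
      hN.integral_exp_inner_setIntegral hB hd hμ Trawl.trawlIntegrand_eq,
      Trawl.integral_exp_inner_trawlIntegrand hν hAt hvol]
  have hC : Trawl.IsCumulantFunction (P.map (Trawl.trawlProcess N A t)) fun θ =>
      ∑ S, ((volume (Trawl.trawlCell (fun i => Trawl.shift (A i) t) S)).toReal : ℂ) *
        Trawl.levyExponent ν (Trawl.extendZero S (Trawl.subvector S θ)) := by
    refine ⟨continuous_finsetSum _ fun S _ => continuous_const.mul
      ((Trawl.continuous_levyExponent ν).comp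
        ((Trawl.continuous_extendZero S).comp (Trawl.continuous_subvector S))), ?_, hchar⟩
    refine Finset.sum_eq_zero fun S _ => ?_
    have h0 : Trawl.subvector S (0 : EuclideanSpace ℝ (Fin n)) = 0 := rfl
    rw [h0, Trawl.extendZero_zero, Trawl.levyExponent_zero, mul_zero]
  refine ⟨fun i => ?_, hmeas, fun S => ?_, ?_, fun θ => ⟨?_, ?_⟩⟩
  · filter_upwards [hint] with ω hω
    exact hω.mono_set (Set.preimage_mono (Set.subset_iUnion (fun i => Trawl.shift (A i) t) i))
  · rw [(hL'.isCumulantFunction_subvector S).cumulantFunction_eq]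
    exact hL'.isCumulantFunction_subvector S
  · rw [hC.cumulantFunction_eq]
    exact hC
  · rw [hC.cumulantFunction_eq, ← hchar, charFun_apply, integral_map hmeas
      (Continuous.aestronglyMeasurable (by fun_prop))]
    refine integral_congr_ae (Filter.Eventually.of_forall fun ω => ?_)
    simp only [PiLp.inner_apply]
    rw [mul_comm]
    rfl
  · rw [hC.cumulantFunction_eq]
    -- Here `f` uses cells of the shifted trawls and `g` exact regions of the unshifted ones; for
    -- nonempty `S` their volumes agree.
    refine (Trawl.sum_powersetCard_eq_sum (by simp [Trawl.trawlCell_empty]) fun S hS => ?_).symm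
    rw [(hL'.isCumulantFunction_subvector S).cumulantFunction_eq, Trawl.trawlCell_eq _ hS,
      Trawl.volume_exactRegion_shift fun i => (hA i).measurableSet]
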